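/- For $m\in\mathbb{Z}_{>0}$ and $\xi$ in a field $F$, let $\mathrm{Jord}_m(\xi)$ denote the $m\times m$ Jordan matrix with diagonal $(\xi,\ldots,\xi)$ and subdiagonal $(1,\ldots,1)$. An endomorphism of a finite dimensional vector space has Jordan form $\mathrm{Jord}_{m_1}(\xi_1)\oplus\cdots\oplus\mathrm{Jord}_{m_q}(\xi_q)$ if its matrix in some basis is this block diagonal matrix; its Jordan blocks are then the blocks $\mathrm{Jord}_{m_i}(\xi_i)$, of rank $m_i$ and with eigenvalue $\xi_i$. Let $F$ be an algebraically closed field of characteristic zero, and let $V\neq\{0\}$ be a finite dimensional vector space over $F$. Let $M$ be an automorphism of $V$ with Jordan form $$\mathrm{Jord}_{m_1}(\xi_1)\oplus\cdots\oplus\mathrm{Jord}_{m_q}(\xi_q),$$ where $q\in\mathbb{Z}_{>0}$, $m\in(\mathbb{Z}_{>0})^q$ and $\xi_i\in F^{\times}$ for $i=1,\ldots,q$. Fix an integer $j>0$. Then the induced automorphism $\wedge^j M$ of $\wedge^j V$ has a Jordan form. For $\zeta\in F$, let $\max_\zeta$ be the maximum of the ranks of the Jordan blocks with eigenvalue $\zeta$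 in any Jordan form of $\wedge^j M$. Let $\mathscr{S}$ be the set of tuples $s\in\mathbb{N}^q$ such that $\sum_{i=1}^q s_i=j$ and $s_i\leq m_i$ for each $i$ (where $0\in\mathbb{N}$). Then for every $\zeta\in F$, $$\mathrm{max}_\zeta=\max\Big\{1+\sum_{i=1}^q s_i(m_i-s_i)\ \Big|\ s\in\mathscr{S},\ \prod_{i=1}^q\xi_i^{s_i}=\zeta\Big\},$$ where on both sides $\max\emptyset=0$. -/

import Mathlib

/-- The Jordan matrix of rank `n` with diagonal `(a, …, a)` and subdiagonal `(1, …, 1)`. -/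
def jordanBlock {F : Type*} [Zero F] [One F] (n : ℕ) (a : F) : Matrix (Fin n) (Fin n) F :=
  Matrix.of fun i k => if i = k then a else if (i : ℕ) = (k : ℕ) + 1 then 1 else 0

/-- The endomorphism `f` has Jordan form `Jord_{n 1}(a 1) ⊕ ⋯ ⊕ Jord_{n r}(a r)`: all ranks `n i`
are positive, and the matrix of `f` in some basis is this block diagonal matrix. -/
def HasJordanForm {F V : Type*} [Field F] [AddCommGroup V] [Module F V] (f : V →ₗ[F] V)
    {r : ℕ} (n : Fin r → ℕ) (a : Fin r → F) : Prop :=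
  (∀ i, 0 < n i) ∧
    ∃ b : Module.Basis (Σ i : Fin r, Fin (n i)) F V,
      LinearMap.toMatrix b b f = Matrix.blockDiagonal' fun i => jordanBlock (n i) (a i)

open Polynomial in
/-- If `E` is a sum of subspaces `W t` on each of which `f - μ t` is nilpotent of index exactly
`d t`, then the multiplicity of `ζ` as a root of the minimal polynomial of `f` is the largest
`d t` with `μ t = ζ`. -/
theorem sup_nilpotency_eq_rootMultiplicity_minpoly {F E T : Type*} [Field F] [DecidableEq F]
    [AddCommGroup E] [Module F E] [FiniteDimensional F E] (f : Module.End F E) (s : Finset T)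
    (W : T → Submodule F E) (hW : ⨆ t ∈ s, W t = ⊤) (μ : T → F) (d : T → ℕ)
    (hker : ∀ t ∈ s, ∀ w ∈ W t, ((f - algebraMap F _ (μ t)) ^ d t) w = 0)
    (hne : ∀ t ∈ s, ∃ w ∈ W t, ((f - algebraMap F _ (μ t)) ^ (d t - 1)) w ≠ 0) (ζ : F) :
    (s.filter fun t => μ t = ζ).sup d = (minpoly F f).rootMultiplicity ζ := by
  have hint : IsIntegral F f := Algebra.IsIntegral.isIntegral f
  have hmin : minpoly F f ≠ 0 := minpoly.ne_zero hint
  have haev : ∀ (c : F) (k : ℕ), aeval f ((X - C c) ^ k) = (f - algebraMap F _ c) ^ k := by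
    intro c k; simp
  apply le_antisymm
  · refine Finset.sup_le fun t ht => ?_
    obtain ⟨hts, rfl⟩ := Finset.mem_filter.1 ht
    obtain ⟨w, hw, hw'⟩ := hne t hts
    by_contra! hlt
    obtain ⟨Q, hQ, hQ'⟩ := exists_eq_pow_rootMultiplicity_mul_and_not_dvd _ hmin (μ t)
    set r := (minpoly F f).rootMultiplicity (μ t)
    have hcop : IsCoprime ((X - C (μ t)) ^ (d t)) Q :=
      IsCoprime.pow_left (((irreducible_X_sub_C _).coprime_iff_not_dvd).2 hQ')
    obtain ⟨A, B, hAB⟩ := hcop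
    apply hw'
    rw [← haev]
    have hr : (X - C (μ t)) ^ (d t - 1) = A * (X - C (μ t)) ^ (d t - 1) * (X - C (μ t)) ^ (d t)
        + B * (X - C (μ t)) ^ (d t - 1 - r) * minpoly F f := by
      have h1 : (X - C (μ t)) ^ (d t - 1) =
          (X - C (μ t)) ^ (d t - 1 - r) * (X - C (μ t)) ^ r := by
        rw [← pow_add]; congr 1; omega
      calc (X - C (μ t)) ^ (d t - 1) = (X - C (μ t)) ^ (d t - 1) *
            (A * (X - C (μ t)) ^ (d t) + B * Q) := by rw [hAB, mul_one]
        _ = A * (X - C (μ t)) ^ (d t - 1) * (X - C (μ t)) ^ (d t)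
            + B * Q * (X - C (μ t)) ^ (d t - 1) := by ring
        _ = A * (X - C (μ t)) ^ (d t - 1) * (X - C (μ t)) ^ (d t) + B * Q *
            ((X - C (μ t)) ^ (d t - 1 - r) * (X - C (μ t)) ^ r) := by rw [← h1]
        _ = _ := by rw [hQ]; ring
    rw [hr, map_add, map_mul, map_mul _ (B * _), minpoly.aeval, mul_zero, add_zero, haev,
      Module.End.mul_apply, hker t hts w hw, map_zero]
  · set D := (s.filter fun t => μ t = ζ).sup d
    set Q : F[X] := ∏ t ∈ s.filter (fun t => μ t ≠ ζ), (X - C (μ t)) ^ d t with hQ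
    have hkill : aeval f ((X - C ζ) ^ D * Q) = 0 := by
      rw [← LinearMap.ker_eq_top, ← top_le_iff, ← hW]
      refine iSup₂_le fun t ht w hw => ?_
      have hdvd : (X - C (μ t)) ^ d t ∣ (X - C ζ) ^ D * Q := by
        by_cases h : μ t = ζ
        · rw [h]
          exact (pow_dvd_pow _ (Finset.le_sup (f := d) (Finset.mem_filter.2 ⟨ht, h⟩))).mul_right _
        · exact (Finset.dvd_prod_of_mem (fun t => (X - C (μ t)) ^ d t)
            (Finset.mem_filter.2 ⟨ht, h⟩)).mul_left _
      obtain ⟨R, hR⟩ := hdvd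
      rw [LinearMap.mem_ker, hR, mul_comm, map_mul, haev, Module.End.mul_apply, hker t ht w hw,
        map_zero]
    have hdvd : (X - C ζ) ^ (minpoly F f).rootMultiplicity ζ ∣ (X - C ζ) ^ D * Q :=
      (pow_rootMultiplicity_dvd _ _).trans (minpoly.dvd F f hkill)
    have hcop : IsCoprime ((X - C ζ) ^ (minpoly F f).rootMultiplicity ζ) Q := by
      refine IsCoprime.prod_right fun t ht => IsCoprime.pow ?_
      exact isCoprime_X_sub_C_of_isUnit_sub
        (sub_ne_zero.2 (Finset.mem_filter.1 ht).2.symm).isUnit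
    exact (pow_dvd_pow_iff (X_sub_C_ne_zero ζ) (not_isUnit_X_sub_C ζ)).1
      (hcop.dvd_of_dvd_mul_right hdvd)

/-- The basis `b` is made of one string `b (i, 0), b (i, 1), …` for each Jordan block: `f` acts by
`b (i, k) ↦ a i • b (i, k) + b (i, k + 1)`. -/
def IsJordanBasis {F V ι : Type*} [Field F] [AddCommGroup V] [Module F V] (f : V →ₗ[F] V)
    (n : ι → ℕ) (a : ι → F) (b : Module.Basis (Σ i, Fin (n i)) F V) : Prop :=
  ∀ i (k : Fin (n i)), f (b ⟨i, k⟩) = a i • b ⟨i, k⟩ +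
    if h : (k : ℕ) + 1 < n i then b ⟨i, ⟨k + 1, h⟩⟩ else 0

theorem toMatrix_eq_blockDiagonal'_jordanBlock_iff {F V : Type*} [Field F] [AddCommGroup V]
    [Module F V] (f : V →ₗ[F] V) {r : ℕ} (n : Fin r → ℕ) (a : Fin r → F)
    (b : Module.Basis (Σ i, Fin (n i)) F V) :
    (LinearMap.toMatrix b b f = Matrix.blockDiagonal' fun i => jordanBlock (n i) (a i)) ↔
      IsJordanBasis f n a b := by
  have key : ∀ x i (k : Fin (n i)), b.repr (a i • b ⟨i, k⟩ +
      if h : (k : ℕ) + 1 < n i then b ⟨i, ⟨k + 1, h⟩⟩ else 0) x =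
      Matrix.blockDiagonal' (fun i => jordanBlock (n i) (a i)) x ⟨i, k⟩ := by
    rintro ⟨i', k'⟩ i k
    rw [Matrix.blockDiagonal'_apply]
    by_cases hi : i' = i
    · subst hi
      have hk : (k' : ℕ) < n i' := k'.2
      simp only [map_add, map_smul, Module.Basis.repr_self, Finsupp.add_apply, Finsupp.smul_apply,
        dif_pos, cast_eq, jordanBlock, Matrix.of_apply, Finsupp.single_apply, Sigma.mk.injEq,
        heq_eq_eq, true_and, smul_eq_mul]
      by_cases h : k = k'
      · subst h
        split_ifs <;> first | omega | simp [Fin.ext_iff]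
      · rw [if_neg h, if_neg (Ne.symm h), mul_zero, zero_add]
        split_ifs with h1 h2 h2
        · have : k' = ⟨k + 1, h1⟩ := Fin.ext h2
          simp [this]
        · simp only [Module.Basis.repr_self, Finsupp.single_apply, Sigma.mk.injEq, heq_eq_eq,
            true_and, Fin.ext_iff]
          rw [if_neg (Ne.symm h2)]
        · omega
        · simp
    · rw [dif_neg hi]
      split_ifs <;> simp [Ne.symm hi]
  constructor
  · intro h i k
    apply b.repr.injective
    ext x
    rw [key, ← h, LinearMap.toMatrix_apply]
  · intro h
    ext x ⟨i, k⟩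
    rw [LinearMap.toMatrix_apply, h, key]

theorem IsJordanBasis.pow_apply {F V ι : Type*} [Field F] [AddCommGroup V] [Module F V]
    {f : V →ₗ[F] V} {n : ι → ℕ} {a : ι → F} {b : Module.Basis (Σ i, Fin (n i)) F V}
    (h : IsJordanBasis f n a b) (i : ι) (k : Fin (n i)) (t : ℕ) :
    ((f - algebraMap F (Module.End F V) (a i)) ^ t) (b ⟨i, k⟩) =
      if h : (k : ℕ) + t < n i then b ⟨i, ⟨k + t, h⟩⟩ else 0 := by
  induction t with
  | zero => simp
  | succ t ih =>
    rw [pow_succ', Module.End.mul_apply, ih]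
    split_ifs with h1 h2 h2
    · rw [LinearMap.sub_apply, h, Module.algebraMap_end_apply, add_sub_cancel_left, dif_pos]
      rfl
    · rw [LinearMap.sub_apply, h, Module.algebraMap_end_apply, add_sub_cancel_left]
      exact dif_neg h2
    · omega
    · simp

theorem HasJordanForm.sup_eq_rootMultiplicity_minpoly {F V : Type*} [Field F] [DecidableEq F]
    [AddCommGroup V] [Module F V] [FiniteDimensional F V] {f : V →ₗ[F] V} {r : ℕ}
    {n : Fin r → ℕ} {a : Fin r → F} (h : HasJordanForm f n a) (ζ : F) :
    (Finset.univ.filter fun k => a k = ζ).sup n =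
      (minpoly F (f : Module.End F V)).rootMultiplicity ζ := by
  obtain ⟨hn, b, hb⟩ := h
  rw [toMatrix_eq_blockDiagonal'_jordanBlock_iff] at hb
  refine sup_nilpotency_eq_rootMultiplicity_minpoly f Finset.univ
    (fun i => Submodule.span F (Set.range fun k : Fin (n i) => b ⟨i, k⟩)) ?_ a n ?_ ?_ ζ
  · rw [← top_le_iff, ← b.span_eq, Submodule.span_le]
    rintro _ ⟨⟨i, k⟩, rfl⟩
    exact (le_iSup₂_of_le (f := fun i (_ : i ∈ Finset.univ) =>
      Submodule.span F (Set.range fun k : Fin (n i) => b ⟨i, k⟩)) i (Finset.mem_univ i) le_rfl)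
      (Submodule.subset_span ⟨k, rfl⟩)
  · intro i _ w hw
    induction hw using Submodule.span_induction with
    | mem x hx =>
      obtain ⟨k, rfl⟩ := hx
      rw [hb.pow_apply, dif_neg (by omega)]
    | zero => simp
    | add x y _ _ hx hy => rw [map_add, hx, hy, add_zero]
    | smul c x _ hx => rw [map_smul, hx, smul_zero]
  · intro i _
    refine ⟨b ⟨i, ⟨0, hn i⟩⟩, Submodule.subset_span ⟨_, rfl⟩, ?_⟩
    have := hn i
    rw [hb.pow_apply, dif_pos (by simp; omega)]
    exact b.ne_zero _

open Polynomial in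
/-- The quotient of `F[X]` by `(X - a) ^ n` has a basis in which multiplication by `X` is a Jordan
block. -/
theorem exists_basis_quotient_X_sub_C_pow {F : Type*} [Field F] (a : F) (n : ℕ) (I : Ideal F[X])
    (hI : I = Ideal.span {(X - C a) ^ n}) :
    ∃ b : Module.Basis (Fin n) F (F[X] ⧸ I), ∀ k : Fin n,
      (X : F[X]) • b k = a • b k + if h : (k : ℕ) + 1 < n then b ⟨k + 1, h⟩ else 0 := by
  subst hI
  set I : Ideal F[X] := Ideal.span {(X - C a) ^ n} with hI
  have hmonic : ((X - C a) ^ n).Monic := (monic_X_sub_C a).pow n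
  have hdeg : ((X - C a) ^ n).natDegree = n := by
    rw [(monic_X_sub_C a).natDegree_pow, natDegree_X_sub_C, mul_one]
  have hfin : Module.finrank F (F[X] ⧸ I) = n := by
    rw [hI, finrank_quotient_span_eq_natDegree, hdeg]
  let v : ℕ → F[X] ⧸ I := fun k => Ideal.Quotient.mk I ((X - C a) ^ k)
  have hli : LinearIndependent F fun k : Fin n => v k := by
    rw [Fintype.linearIndependent_iff]
    intro c hc
    let P : F[X] := ∑ k : Fin n, C (c k) * X ^ (k : ℕ)
    have hcomp : P.comp (X - C a) = ∑ k : Fin n, c k • (X - C a) ^ (k : ℕ) := by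
      simp only [P, ← coe_compRingHom_apply, map_sum]
      simp [smul_eq_C_mul]
    have hmem : P.comp (X - C a) ∈ I := by
      rw [hcomp, ← Ideal.Quotient.eq_zero_iff_mem, ← hc]
      exact map_sum (Ideal.Quotient.mkₐ F I).toLinearMap _ _ |>.trans (by simp [v])
    have hPdeg : P.degree < n := by
      refine (degree_sum_le _ _).trans_lt
        ((Finset.sup_lt_iff (by exact_mod_cast WithBot.bot_lt_coe n)).2 fun k _ => ?_)
      exact (degree_C_mul_X_pow_le _ _).trans_lt (by exact_mod_cast k.2)
    have hP : P = 0 := by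
      by_contra hP
      have h0 : P.comp (X - C a) ≠ 0 := by
        rw [Ne, comp_eq_zero_iff, not_or, not_and]
        exact ⟨hP, fun _ h => absurd (congrArg natDegree h) (by simp)⟩
      have h1 := natDegree_le_of_dvd (Ideal.mem_span_singleton.1 hmem) h0
      rw [hdeg, natDegree_comp, natDegree_X_sub_C, mul_one] at h1
      exact absurd ((natDegree_lt_iff_degree_lt hP).2 hPdeg) (by omega)
    intro k
    have := congrArg (fun Q => Q.coeff (k : ℕ)) hP
    simpa [P, finsetSum_coeff, coeff_C_mul, coeff_X_pow, Fin.val_inj] using this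
  have : Module.Finite F (F[X] ⧸ I) := hmonic.finite_quotient
  refine ⟨Module.Basis.mk hli (hli.span_eq_top_of_card_eq_finrank' (by simp [hfin])).ge, ?_⟩
  intro k
  have hstep : (X : F[X]) • v k = a • v k + v (k + 1) := by
    change Ideal.Quotient.mk I (X * (X - C a) ^ (k : ℕ)) =
      Ideal.Quotient.mk I (a • (X - C a) ^ (k : ℕ) + (X - C a) ^ ((k : ℕ) + 1))
    congr 1
    rw [smul_eq_C_mul]
    ring
  simp only [Module.Basis.mk_apply]
  rw [hstep]
  split_ifs with h
  · rfl
  · congr 1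
    have : (k : ℕ) + 1 = n := by omega
    rw [this]
    exact Ideal.Quotient.eq_zero_iff_mem.2 (Ideal.mem_span_singleton_self _)

theorem IsJordanBasis.hasJordanForm {F V ι : Type*} [Field F] [AddCommGroup V] [Module F V]
    [Fintype ι] {f : V →ₗ[F] V} {n : ι → ℕ} {a : ι → F} {b : Module.Basis (Σ i, Fin (n i)) F V}
    (h : IsJordanBasis f n a b) :
    ∃ (r : ℕ) (n' : Fin r → ℕ) (a' : Fin r → F), HasJordanForm f n' a' := by
  classical
  let ε : Fin (Fintype.card {i // 0 < n i}) ≃ {i // 0 < n i} := (Fintype.equivFin _).symm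
  let τ : (Σ i, Fin (n i)) ≃ Σ k, Fin (n (ε k)) :=
    { toFun := fun x => ⟨ε.symm ⟨x.1, x.2.pos⟩, Fin.cast (by simp) x.2⟩
      invFun := fun y => ⟨ε y.1, y.2⟩
      left_inv := by
        rintro ⟨i, k⟩
        refine Sigma.ext (by simp) ?_
        simp only
        rw [Fin.heq_ext_iff (by simp)]
        rfl
      right_inv := by
        rintro ⟨i, k⟩
        refine Sigma.ext (by simp) ?_
        simp only
        rw [Fin.heq_ext_iff (by simp)]
        rfl }
  refine ⟨_, fun k => n (ε k), fun k => a (ε k), fun k => (ε k).2, b.reindex τ, ?_⟩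
  rw [toMatrix_eq_blockDiagonal'_jordanBlock_iff]
  intro i k
  simp only [Module.Basis.reindex_apply]
  exact h (ε i) k

open Polynomial in
/-- **Jordan normal form**: an endomorphism of a finite dimensional vector space over an
algebraically closed field has a Jordan form. -/
theorem exists_hasJordanForm {F V : Type*} [Field F] [IsAlgClosed F] [AddCommGroup V] [Module F V]
    [FiniteDimensional F V] (f : V →ₗ[F] V) :
    ∃ (r : ℕ) (n : Fin r → ℕ) (a : Fin r → F), HasJordanForm f n a := by
  classical
  obtain ⟨ι, _, p, hp, n, ⟨φ⟩⟩ := Module.equiv_directSum_of_isTorsion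
    (R := F[X]) (M := Module.AEval' f)
    (Module.AEval.isTorsion_of_finiteDimensional F V (f : Module.End F V))
  have hroot : ∀ i, ∃ a : F, Associated (X - C a) (p i) := fun i => by
    obtain ⟨a, ha⟩ := IsAlgClosed.exists_root (p i)
      (by rw [IsAlgClosed.degree_eq_one_of_irreducible F (hp i)]; exact one_ne_zero)
    exact ⟨a, (irreducible_X_sub_C a).associated_of_dvd (hp i) (dvd_iff_isRoot.2 ha)⟩
  choose a ha using hroot
  have hblock := fun i => exists_basis_quotient_X_sub_C_pow (a i) (n i) (Ideal.span {p i ^ n i})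
    (Ideal.span_singleton_eq_span_singleton.2 ((ha i).pow_pow.symm))
  choose b hb using hblock
  let ψ : V ≃ₗ[F] DirectSum ι fun i => F[X] ⧸ Submodule.span F[X] {p i ^ n i} :=
    (Module.AEval'.of f).trans (φ.restrictScalars F)
  have hψ : ∀ v, ψ (f v) = (X : F[X]) • ψ v := fun v => by
    change φ (Module.AEval'.of f (f v)) = (X : F[X]) • φ (Module.AEval'.of f v)
    rw [← Module.AEval'.X_smul_of, map_smul]
  let B : Module.Basis (Σ i, Fin (n i)) F V := (DFinsupp.basis b).map ψ.symm
  have hB : ∀ i k, ψ (B ⟨i, k⟩) = DirectSum.lof F[X] ι _ i (b i k) := fun i k => by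
    simp only [B, Module.Basis.map_apply, LinearEquiv.apply_symm_apply]
    apply (DFinsupp.basis b).repr.injective
    rw [Module.Basis.repr_self]
    ext ⟨i', k'⟩
    change _ = (b i').repr (DirectSum.lof F[X] ι (fun i => F[X] ⧸ Ideal.span {p i ^ n i}) i
      (b i k) i') k'
    by_cases h : i = i'
    · subst h
      rw [DirectSum.lof_apply, Module.Basis.repr_self]
      simp [Finsupp.single_apply]
    · rw [DirectSum.lof_eq_of, DirectSum.of_eq_of_ne _ _ _ (Ne.symm h)]
      simp [h]
  refine IsJordanBasis.hasJordanForm (n := n) (a := a) (b := B) fun i k => ψ.injective ?_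
  rw [hψ, map_add, map_smul, hB, ← map_smul, hb, map_add]
  congr 1
  · exact LinearMap.map_smul_of_tower _ _ _
  · split_ifs
    · rw [hB]
    · simp

open Set.powersetCard in
theorem sum_powersetCard_eq_sum_ofFinEmbEquiv {κ A : Type*} [LinearOrder κ] [AddCommMonoid A]
    {j : ℕ} (I : Set.powersetCard κ j) (g : κ → A) :
    ∑ x ∈ I.val, g x = ∑ k, g (ofFinEmbEquiv.symm I k) := by
  rw [← Finset.sum_image (s := Finset.univ) (g := fun k => ofFinEmbEquiv.symm I k)
    (f := g) (fun x _ y _ h => (ofFinEmbEquiv.symm I).injective h)]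
  congr 1
  ext x
  have := mem_range_ofFinEmbEquiv_symm_iff_mem I x
  simp only [Set.mem_range] at this
  simp only [Finset.mem_image, Finset.mem_univ, true_and]
  exact this.symm

/-- The additive monoid generated by the members of the basis of `⋀[F]^j V` induced by `b` whose
indices satisfy `P`. -/
noncomputable def exteriorCone {F V κ : Type*} [Field F] [AddCommGroup V] [Module F V]
    [LinearOrder κ] (b : Module.Basis κ F V) (j : ℕ) (P : Set.powersetCard κ j → Prop) :
    AddSubmonoid (⋀[F]^j V) :=
  AddSubmonoid.closure (b.exteriorPower j '' {I | P I})

theorem exteriorCone_mono {F V κ : Type*} [Field F] [AddCommGroup V] [Module F V]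
    [LinearOrder κ] (b : Module.Basis κ F V) (j : ℕ) {P Q : Set.powersetCard κ j → Prop}
    (h : ∀ I, P I → Q I) : exteriorCone b j P ≤ exteriorCone b j Q :=
  AddSubmonoid.closure_mono (Set.image_mono h)

theorem repr_mem_exteriorCone {F V κ : Type*} [Field F] [AddCommGroup V] [Module F V]
    [LinearOrder κ] (b : Module.Basis κ F V) (j : ℕ) {P : Set.powersetCard κ j → Prop}
    {v : ⋀[F]^j V} (hv : v ∈ exteriorCone b j P) (I : Set.powersetCard κ j) :
    ∃ c : ℕ, (b.exteriorPower j).repr v I = c := by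
  classical
  induction hv using AddSubmonoid.closure_induction with
  | mem x hx =>
    obtain ⟨J, -, rfl⟩ := hx
    rw [Module.Basis.repr_self, Finsupp.single_apply]
    split_ifs
    · exact ⟨1, by simp⟩
    · exact ⟨0, by simp⟩
  | zero => exact ⟨0, by simp⟩
  | add x y _ _ hx hy =>
    obtain ⟨c, hc⟩ := hx
    obtain ⟨d, hd⟩ := hy
    exact ⟨c + d, by simp [hc, hd]⟩

/-- Moving the members of `I` outside `S` one step to the right gives a member of the basis of
`⋀[F]^j V`, unless two of them collide. -/
theorem exists_ιMulti_piecewise_eq {F V κ A : Type*} [Field F] [AddCommGroup V] [Module F V]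
    [LinearOrder κ] [AddCommMonoid A] (b : Module.Basis κ F V) {nxt : κ → Option κ}
    (hcov : ∀ x y, nxt x = some y → x ⋖ y) {g : κ → A} (hg : ∀ x y, nxt x = some y → g y = g x)
    {w : κ → ℕ} (hw : ∀ x y, nxt x = some y → w y = w x + 1) {j : ℕ} (I : Set.powersetCard κ j)
    (S : Finset (Fin j)) (a : Fin j → κ) (ha : Function.Injective a)
    (hS : ∀ k ∈ S, a k = Set.powersetCard.ofFinEmbEquiv.symm I k)
    (hS' : ∀ k ∉ S, nxt (Set.powersetCard.ofFinEmbEquiv.symm I k) = some (a k)) :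
    ∃ I' : Set.powersetCard κ j, exteriorPower.ιMulti F j (b ∘ a) = b.exteriorPower j I' ∧
      ∑ x ∈ I'.val, g x = ∑ x ∈ I.val, g x ∧
      ∑ x ∈ I'.val, w x = ∑ x ∈ I.val, w x + Sᶜ.card := by
  have hmono : StrictMono a := by
    refine Monotone.strictMono_of_injective (fun k l hkl => ?_) ha
    rcases hkl.eq_or_lt with rfl | hkl
    · exact le_rfl
    have hlt := (Set.powersetCard.ofFinEmbEquiv.symm I).strictMono hkl
    have h1 : a k ≤ Set.powersetCard.ofFinEmbEquiv.symm I l := by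
      by_cases hk : k ∈ S
      · rw [hS k hk]; exact hlt.le
      · exact (hcov _ _ (hS' k hk)).ge_of_gt hlt
    refine h1.trans ?_
    by_cases hl : l ∈ S
    · rw [hS l hl]
    · exact (hcov _ _ (hS' l hl)).lt.le
  have happ : ∀ k, Set.powersetCard.ofFinEmbEquiv.symm
      (Set.powersetCard.ofFinEmbEquiv (OrderEmbedding.ofStrictMono a hmono)) k = a k := fun k => by
    rw [Equiv.symm_apply_apply]; rfl
  refine ⟨Set.powersetCard.ofFinEmbEquiv (OrderEmbedding.ofStrictMono a hmono), ?_, ?_, ?_⟩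
  · rw [exteriorPower.basis_apply, exteriorPower.ιMulti_family]
    congr 1
    ext k
    rw [Function.comp_apply, Function.comp_apply, happ]
  · simp only [sum_powersetCard_eq_sum_ofFinEmbEquiv, happ]
    refine Finset.sum_congr rfl fun k _ => ?_
    by_cases hk : k ∈ S
    · rw [hS k hk]
    · rw [hg _ _ (hS' k hk)]
  · simp only [sum_powersetCard_eq_sum_ofFinEmbEquiv, happ]
    have hcard : Sᶜ.card = ∑ k, if k ∈ S then 0 else 1 := by
      simp [Finset.sum_ite, Finset.filter_not, Finset.compl_eq_univ_sdiff]
    rw [hcard, ← Finset.sum_add_distrib]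
    refine Finset.sum_congr rfl fun k _ => ?_
    by_cases hk : k ∈ S
    · rw [hS k hk, if_pos hk, add_zero]
    · rw [hw _ _ (hS' k hk), if_neg hk]

theorem map_exteriorPower_basis_eq_sum {F V κ : Type*} [Field F] [AddCommGroup V] [Module F V]
    [LinearOrder κ] (b : Module.Basis κ F V) {nxt : κ → Option κ} {f : V →ₗ[F] V} {ξ : κ → F}
    (hf : ∀ x, f (b x) = ξ x • (b x + (nxt x).elim 0 b)) {j : ℕ} (I : Set.powersetCard κ j) :
    exteriorPower.map j f (b.exteriorPower j I) = (∏ x ∈ I.val, ξ x) •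
      ∑ S : Finset (Fin j), exteriorPower.ιMulti F j
        (S.piecewise (b ∘ Set.powersetCard.ofFinEmbEquiv.symm I)
          fun k => (nxt (Set.powersetCard.ofFinEmbEquiv.symm I k)).elim 0 b) := by
  have hprod : ∏ x ∈ I.val, ξ x = ∏ k, ξ (Set.powersetCard.ofFinEmbEquiv.symm I k) :=
    sum_powersetCard_eq_sum_ofFinEmbEquiv (A := Additive F) I ξ
  rw [exteriorPower.basis_apply, exteriorPower.ιMulti_family, exteriorPower.map_apply_ιMulti,
    hprod]
  have hfb : f ∘ b ∘ Set.powersetCard.ofFinEmbEquiv.symm I = fun k =>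
      ξ (Set.powersetCard.ofFinEmbEquiv.symm I k) • ((b ∘ Set.powersetCard.ofFinEmbEquiv.symm I) +
        fun k => (nxt (Set.powersetCard.ofFinEmbEquiv.symm I k)).elim 0 b) k := by
    ext k
    exact hf _
  rw [hfb]
  have h1 := (exteriorPower.ιMulti F j (M := V)).toMultilinearMap.map_smul_univ
    (fun k => ξ (Set.powersetCard.ofFinEmbEquiv.symm I k))
    ((b ∘ Set.powersetCard.ofFinEmbEquiv.symm I) +
        fun k => (nxt (Set.powersetCard.ofFinEmbEquiv.symm I k)).elim 0 b)
  rw [MultilinearMap.map_add_univ] at h1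
  exact h1

theorem ιMulti_piecewise_mem_exteriorCone {F V κ A : Type*} [Field F] [AddCommGroup V] [Module F V]
    [LinearOrder κ] [AddCommMonoid A] (b : Module.Basis κ F V) {nxt : κ → Option κ}
    (hcov : ∀ x y, nxt x = some y → x ⋖ y) {g : κ → A} (hg : ∀ x y, nxt x = some y → g y = g x)
    {w : κ → ℕ} (hw : ∀ x y, nxt x = some y → w y = w x + 1) {j : ℕ} (I : Set.powersetCard κ j)
    (S : Finset (Fin j)) (hS : S ≠ Finset.univ) :
    exteriorPower.ιMulti F j
        (S.piecewise (b ∘ Set.powersetCard.ofFinEmbEquiv.symm I)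
          fun k => (nxt (Set.powersetCard.ofFinEmbEquiv.symm I k)).elim 0 b) ∈
      exteriorCone b j fun I' => ∑ x ∈ I'.val, g x = ∑ x ∈ I.val, g x ∧
        ∑ x ∈ I.val, w x < ∑ x ∈ I'.val, w x := by
  by_cases hn : ∃ k ∉ S, nxt (Set.powersetCard.ofFinEmbEquiv.symm I k) = none
  · obtain ⟨k, hk, hnk⟩ := hn
    rw [(exteriorPower.ιMulti F j (M := V)).map_coord_zero k (by simp [hk, hnk])]
    exact zero_mem _
  · have hex : ∀ k, ∃ y, (k ∈ S → y = Set.powersetCard.ofFinEmbEquiv.symm I k) ∧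
        (k ∉ S → nxt (Set.powersetCard.ofFinEmbEquiv.symm I k) = some y) := by
      intro k
      by_cases hk : k ∈ S
      · exact ⟨_, fun _ => rfl, fun h => absurd hk h⟩
      · obtain ⟨y, hy⟩ := Option.ne_none_iff_exists'.1 fun h => hn ⟨k, hk, h⟩
        exact ⟨y, fun h => absurd h hk, fun _ => hy⟩
    choose a ha ha' using hex
    have heq : S.piecewise (b ∘ Set.powersetCard.ofFinEmbEquiv.symm I)
        (fun k => (nxt (Set.powersetCard.ofFinEmbEquiv.symm I k)).elim 0 b) = b ∘ a := by
      ext k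
      by_cases hk : k ∈ S
      · simp [hk, ha k hk]
      · simp [hk, ha' k hk]
    rw [heq]
    by_cases hinj : Function.Injective a
    · obtain ⟨I', h1, h2, h3⟩ := exists_ιMulti_piecewise_eq b hcov hg hw I S a hinj ha ha'
      have : 0 < Sᶜ.card := by
        rw [Finset.card_pos, Finset.nonempty_iff_ne_empty, Ne, Finset.compl_eq_empty_iff]
        exact hS
      rw [h1]
      exact AddSubmonoid.subset_closure ⟨I', ⟨h2, by omega⟩, rfl⟩
    · rw [AlternatingMap.map_eq_zero_of_not_injective _ _
        fun h => hinj (Function.Injective.of_comp h)]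
      exact zero_mem _

theorem exists_map_exteriorPower_basis_eq {F V κ A : Type*} [Field F] [AddCommGroup V] [Module F V]
    [LinearOrder κ] [AddCommMonoid A] (b : Module.Basis κ F V) {nxt : κ → Option κ}
    (hcov : ∀ x y, nxt x = some y → x ⋖ y) {g : κ → A} (hg : ∀ x y, nxt x = some y → g y = g x)
    {w : κ → ℕ} (hw : ∀ x y, nxt x = some y → w y = w x + 1) {f : V →ₗ[F] V} {ξ : κ → F}
    (hf : ∀ x, f (b x) = ξ x • (b x + (nxt x).elim 0 b)) {j : ℕ} (I : Set.powersetCard κ j) :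
    ∃ r ∈ exteriorCone b j fun I' => ∑ x ∈ I'.val, g x = ∑ x ∈ I.val, g x ∧
        ∑ x ∈ I.val, w x < ∑ x ∈ I'.val, w x,
      exteriorPower.map j f (b.exteriorPower j I) =
        (∏ x ∈ I.val, ξ x) • (b.exteriorPower j I + r) := by
  rw [map_exteriorPower_basis_eq_sum b hf, ← Finset.add_sum_erase _ _ (Finset.mem_univ Finset.univ),
    Finset.piecewise_univ]
  refine ⟨_, sum_mem (t := Finset.univ.erase Finset.univ) fun S hS =>
    ιMulti_piecewise_mem_exteriorCone b hcov hg hw I S (Finset.ne_of_mem_erase hS), ?_⟩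
  rw [exteriorPower.basis_apply, exteriorPower.ιMulti_family]

theorem exists_map_exteriorPower_basis_eq_of_nxt {F V κ A : Type*} [Field F] [AddCommGroup V]
    [Module F V] [LinearOrder κ] [AddCommMonoid A] (b : Module.Basis κ F V) {nxt : κ → Option κ}
    (hcov : ∀ x y, nxt x = some y → x ⋖ y) {g : κ → A} (hg : ∀ x y, nxt x = some y → g y = g x)
    {w : κ → ℕ} (hw : ∀ x y, nxt x = some y → w y = w x + 1) {f : V →ₗ[F] V} {ξ : κ → F}
    (hf : ∀ x, f (b x) = ξ x • (b x + (nxt x).elim 0 b)) {j : ℕ} (I : Set.powersetCard κ j)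
    {x y : κ} (hx : x ∈ I.val) (hy : y ∉ I.val) (hxy : nxt x = some y) :
    ∃ I' : Set.powersetCard κ j, ∑ x ∈ I'.val, g x = ∑ x ∈ I.val, g x ∧
      ∑ x ∈ I'.val, w x = ∑ x ∈ I.val, w x + 1 ∧
    ∃ r ∈ exteriorCone b j fun I' => ∑ x ∈ I'.val, g x = ∑ x ∈ I.val, g x ∧
        ∑ x ∈ I.val, w x < ∑ x ∈ I'.val, w x,
      exteriorPower.map j f (b.exteriorPower j I) =
        (∏ x ∈ I.val, ξ x) • (b.exteriorPower j I + b.exteriorPower j I' + r) := by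
  obtain ⟨k₀, hk₀⟩ := (Set.powersetCard.mem_range_ofFinEmbEquiv_symm_iff_mem I x).2 hx
  have hk : ∀ k, Set.powersetCard.ofFinEmbEquiv.symm I k ≠ y := fun k h =>
    hy ((Set.powersetCard.mem_range_ofFinEmbEquiv_symm_iff_mem I y).1 ⟨k, h⟩)
  let a : Fin j → κ := Function.update (Set.powersetCard.ofFinEmbEquiv.symm I) k₀ y
  have ha : Function.Injective a := by
    intro k l hkl
    simp only [a, Function.update_apply] at hkl
    split_ifs at hkl with h1 h2 h2
    · rw [h1, h2]
    · exact absurd hkl.symm (hk l)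
    · exact absurd hkl (hk k)
    · exact (Set.powersetCard.ofFinEmbEquiv.symm I).injective hkl
  have ha₀ : ∀ k ∈ Finset.univ.erase k₀, a k = Set.powersetCard.ofFinEmbEquiv.symm I k :=
    fun k hk => Function.update_of_ne (Finset.ne_of_mem_erase hk) _ _
  have ha₁ : ∀ k ∉ Finset.univ.erase k₀,
      nxt (Set.powersetCard.ofFinEmbEquiv.symm I k) = some (a k) := by
    intro k hk
    obtain rfl : k = k₀ := by simpa using hk
    rw [hk₀, hxy]
    simp [a]
  obtain ⟨I', h1, h2, h3⟩ := exists_ιMulti_piecewise_eq b hcov hg hw I _ a ha ha₀ ha₁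
  have heq : (Finset.univ.erase k₀).piecewise (b ∘ Set.powersetCard.ofFinEmbEquiv.symm I)
      (fun k => (nxt (Set.powersetCard.ofFinEmbEquiv.symm I k)).elim 0 b) = b ∘ a := by
    ext k
    by_cases hk : k ∈ Finset.univ.erase k₀
    · rw [Finset.piecewise_eq_of_mem _ _ _ hk, Function.comp_apply, Function.comp_apply, ha₀ k hk]
    · rw [Finset.piecewise_eq_of_notMem _ _ _ hk, ha₁ k hk]
      rfl
  refine ⟨I', h2, by simpa [Finset.compl_erase] using h3, ?_⟩
  have hmem : Finset.univ.erase k₀ ∈ (Finset.univ : Finset (Finset (Fin j))).erase Finset.univ := by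
    simp
  rw [map_exteriorPower_basis_eq_sum b hf, ← Finset.add_sum_erase _ _ (Finset.mem_univ Finset.univ),
    Finset.piecewise_univ, ← Finset.add_sum_erase _ _ hmem, heq, h1, ← add_assoc]
  refine ⟨_, sum_mem (t := (Finset.univ.erase Finset.univ).erase (Finset.univ.erase k₀))
    fun S hS => ιMulti_piecewise_mem_exteriorCone b hcov hg hw I S
      (Finset.ne_of_mem_erase (Finset.mem_of_mem_erase hS)), ?_⟩
  rw [exteriorPower.basis_apply F j b I, exteriorPower.ιMulti_family]

theorem sum_range_card_le_sum (A : Finset ℕ) : ∑ k ∈ Finset.range A.card, k ≤ ∑ k ∈ A, k := by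
  induction A using Finset.induction_on_max with
  | empty => simp
  | insert a A ha ih =>
    have hnot : a ∉ A := fun h => lt_irrefl _ (ha a h)
    have hcard : A.card ≤ a := by
      simpa using Finset.card_le_card (fun x hx => Finset.mem_range.2 (ha x hx) : A ⊆ Finset.range a)
    rw [Finset.card_insert_of_notMem hnot, Finset.sum_range_succ, Finset.sum_insert hnot]
    omega

theorem sum_le_sum_range_card_add (A : Finset ℕ) :
    ∀ m, A ⊆ Finset.range m →
      ∑ k ∈ A, k ≤ ∑ k ∈ Finset.range A.card, k + A.card * (m - A.card) := by
  induction A using Finset.induction_on_max with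
  | empty => simp
  | insert a A ha ih =>
    intro m hm
    have hnot : a ∉ A := fun h => lt_irrefl _ (ha a h)
    have hA : A ⊆ Finset.range a := fun x hx => Finset.mem_range.2 (ha x hx)
    have hcard : A.card ≤ a := by simpa using Finset.card_le_card hA
    have ham : a < m := Finset.mem_range.1 (hm (Finset.mem_insert_self a A))
    have h := ih a hA
    rw [Finset.card_insert_of_notMem hnot, Finset.sum_range_succ, Finset.sum_insert hnot]
    obtain ⟨c, rfl⟩ := Nat.exists_eq_add_of_le hcard
    obtain ⟨d, rfl⟩ := Nat.exists_eq_add_of_lt ham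
    have h1 : A.card + c - A.card = c := by omega
    have h2 : A.card + c + d + 1 - (A.card + 1) = c + d := by omega
    rw [h1] at h
    rw [h2]
    nlinarith

theorem sum_eq_sum_range_card_add (A : Finset ℕ) (m : ℕ) (hA : A ⊆ Finset.range m)
    (h : ∀ k ∈ A, k + 1 < m → k + 1 ∈ A) :
    ∑ k ∈ A, k = ∑ k ∈ Finset.range A.card, k + A.card * (m - A.card) := by
  rcases A.eq_empty_or_nonempty with rfl | hne
  · simp
  obtain ⟨a, haA, ha⟩ : ∃ a ∈ A, ∀ k ∈ A, a ≤ k := ⟨A.min' hne, A.min'_mem hne, A.min'_le⟩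
  have ham := Finset.mem_range.1 (hA haA)
  have hup : ∀ t, a + t < m → a + t ∈ A := by
    intro t
    induction t with
    | zero => exact fun _ => haA
    | succ t ih => exact fun ht => h _ (ih (by omega)) ht
  have hIco : A = Finset.Ico a m := by
    ext k
    rw [Finset.mem_Ico]
    refine ⟨fun hk => ⟨ha k hk, Finset.mem_range.1 (hA hk)⟩, fun hk => ?_⟩
    have := hup (k - a) (by omega)
    rwa [Nat.add_sub_cancel' hk.1] at this
  rw [hIco, Nat.card_Ico, Finset.sum_Ico_eq_sum_range, Finset.sum_add_distrib, Finset.sum_const,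
    Finset.card_range, smul_eq_mul, Nat.sub_sub_self ham.le, add_comm]

section Slice

variable {q : ℕ} {m : Fin q → ℕ}

/-- The point to the right of `x` in the same block, if there is one. -/
def nextInBlock (x : Σₗ i, Fin (m i)) : Option (Σₗ i, Fin (m i)) :=
  if h : ((ofLex x).2 : ℕ) + 1 < m (ofLex x).1 then some (toLex ⟨(ofLex x).1, ⟨_, h⟩⟩) else none

theorem nextInBlock_eq_some {x y : Σₗ i, Fin (m i)} (h : nextInBlock x = some y) :
    (ofLex y).1 = (ofLex x).1 ∧ ((ofLex y).2 : ℕ) = (ofLex x).2 + 1 := by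
  rw [nextInBlock] at h
  split_ifs at h with hx
  rw [← Option.some.inj h]
  exact ⟨rfl, rfl⟩

theorem covBy_of_nextInBlock_eq_some {x y : Σₗ i, Fin (m i)} (h : nextInBlock x = some y) :
    x ⋖ y := by
  rw [nextInBlock] at h
  split_ifs at h with hx
  rw [← Option.some.inj h]
  obtain ⟨i, k⟩ := x
  constructor
  · exact Sigma.Lex.right _ _ (Fin.lt_def.2 (Nat.lt_succ_self _))
  · rintro ⟨i', k'⟩ h1 h2
    rcases h1 with ⟨_, _, h1⟩ | ⟨_, _, h1⟩
    · rcases h2 with ⟨_, _, h2⟩ | ⟨_, _, h2⟩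
      · exact lt_asymm h1 h2
      · exact lt_irrefl _ h1
    · rcases h2 with ⟨_, _, h2⟩ | ⟨_, _, h2⟩
      · exact lt_irrefl _ h2
      · exact absurd (Fin.lt_def.1 h1) (Nat.lt_succ_iff.1 (Fin.lt_def.1 h2)).not_gt

/-- The positions of the members of `I` that lie in the block `i`. -/
def slice (I : Finset (Σₗ i, Fin (m i))) (i : Fin q) : Finset ℕ :=
  (I.filter fun x => (ofLex x).1 = i).image fun x => ((ofLex x).2 : ℕ)

theorem mem_slice {I : Finset (Σₗ i, Fin (m i))} {i : Fin q} {k : ℕ} :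
    k ∈ slice I i ↔ ∃ h : k < m i, (toLex ⟨i, ⟨k, h⟩⟩ : Σₗ i, Fin (m i)) ∈ I := by
  simp only [slice, Finset.mem_image, Finset.mem_filter]
  constructor
  · rintro ⟨x, ⟨hx, rfl⟩, rfl⟩
    exact ⟨(ofLex x).2.2, hx⟩
  · rintro ⟨h, hx⟩
    exact ⟨_, ⟨hx, rfl⟩, rfl⟩

theorem slice_subset_range (I : Finset (Σₗ i, Fin (m i))) (i : Fin q) :
    slice I i ⊆ Finset.range (m i) := fun _ hk =>
  Finset.mem_range.2 (mem_slice.1 hk).choose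

@[to_additive]
theorem prod_eq_prod_slice {A : Type*} [CommMonoid A] (I : Finset (Σₗ i, Fin (m i)))
    (φ : Fin q → ℕ → A) :
    ∏ x ∈ I, φ (ofLex x).1 (ofLex x).2 = ∏ i, ∏ k ∈ slice I i, φ i k := by
  rw [← Finset.prod_fiberwise I fun x => (ofLex x).1]
  refine Finset.prod_congr rfl fun i _ => ?_
  rw [slice, Finset.prod_image]
  · exact Finset.prod_congr rfl fun x hx =>
      congrArg (fun t => φ t ((ofLex x).2 : ℕ)) (Finset.mem_filter.1 hx).2
  · rintro ⟨i₁, k₁⟩ h₁ ⟨i₂, k₂⟩ h₂ h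
    obtain rfl : i₁ = i := (Finset.mem_filter.1 h₁).2
    obtain rfl : i₂ = i₁ := (Finset.mem_filter.1 h₂).2
    obtain rfl : k₁ = k₂ := Fin.ext h
    rfl

theorem card_slice (I : Finset (Σₗ i, Fin (m i))) (i : Fin q) :
    (∑ x ∈ I, (Pi.single (ofLex x).1 1 : Fin q → ℕ)) i = (slice I i).card := by
  rw [sum_eq_sum_slice I fun i _ => (Pi.single i 1 : Fin q → ℕ), Finset.sum_apply]
  rw [Finset.sum_eq_single i]
  · simp
  · intro i' _ hi'
    simp [Ne.symm hi']
  · simp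

theorem prod_eq_prod_pow_card_slice {A : Type*} [CommMonoid A] (I : Finset (Σₗ i, Fin (m i)))
    (ξ : Fin q → A) : ∏ x ∈ I, ξ (ofLex x).1 = ∏ i, ξ i ^ (slice I i).card := by
  rw [prod_eq_prod_slice I fun i _ => ξ i]
  simp

theorem card_eq_sum_card_slice (I : Finset (Σₗ i, Fin (m i))) :
    I.card = ∑ i, (slice I i).card := by
  rw [Finset.card_eq_sum_ones, sum_eq_sum_slice I fun _ _ => 1]
  simp

theorem exists_nextInBlock_eq_some_of_sum_lt (I : Finset (Σₗ i, Fin (m i)))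
    (h : ∑ x ∈ I, ((ofLex x).2 : ℕ) < ∑ i, (∑ k ∈ Finset.range (slice I i).card, k +
      (slice I i).card * (m i - (slice I i).card))) :
    ∃ x ∈ I, ∃ y ∉ I, nextInBlock x = some y := by
  rw [sum_eq_sum_slice I fun _ k => k] at h
  obtain ⟨i, -, hi⟩ := Finset.exists_lt_of_sum_lt h
  by_contra! hno
  refine hi.ne (sum_eq_sum_range_card_add _ _ (slice_subset_range I i) fun k hk hk1 => ?_)
  obtain ⟨hkm, hkI⟩ := mem_slice.1 hk
  rw [mem_slice]
  refine ⟨hk1, ?_⟩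
  by_contra hnot
  exact hno _ hkI _ hnot (dif_pos hk1)

theorem exists_slice_eq_range (s : Fin q → ℕ) (hs : s ≤ m) :
    ∃ I : Finset (Σₗ i, Fin (m i)), ∀ i, slice I i = Finset.range (s i) := by
  refine ⟨Finset.univ.filter fun x => ((ofLex x).2 : ℕ) < s (ofLex x).1, fun i => ?_⟩
  ext k
  simp only [mem_slice, Finset.mem_filter, Finset.mem_univ, true_and, ofLex_toLex, Finset.mem_range]
  exact ⟨fun h => h.2, fun h => ⟨h.trans_le (hs i), h⟩⟩

end Slice

theorem pow_mem_exteriorCone {F V κ A : Type*} [Field F] [AddCommGroup V] [Module F V]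
    [LinearOrder κ] [AddCommMonoid A] (b : Module.Basis κ F V) {nxt : κ → Option κ}
    (hcov : ∀ x y, nxt x = some y → x ⋖ y) {g : κ → A} (hg : ∀ x y, nxt x = some y → g y = g x)
    {w : κ → ℕ} (hw : ∀ x y, nxt x = some y → w y = w x + 1) {f : V →ₗ[F] V} {ξ : κ → F}
    (hf : ∀ x, f (b x) = ξ x • (b x + (nxt x).elim 0 b)) {j : ℕ} {γ : A} {z : F} (hz : z ≠ 0)
    (hγ : ∀ I : Set.powersetCard κ j, ∑ x ∈ I.val, g x = γ → ∏ x ∈ I.val, ξ x = z) (d t : ℕ)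
    {v : ⋀[F]^j V}
    (hv : v ∈ exteriorCone b j fun I => ∑ x ∈ I.val, g x = γ ∧ d ≤ ∑ x ∈ I.val, w x) :
    ((z⁻¹ • exteriorPower.map j f - 1 : Module.End F (⋀[F]^j V)) ^ t) v ∈
      exteriorCone b j fun I => ∑ x ∈ I.val, g x = γ ∧ d + t ≤ ∑ x ∈ I.val, w x := by
  induction t with
  | zero => exact hv
  | succ t ih =>
    rw [pow_succ', Module.End.mul_apply]
    refine AddSubmonoid.closure_induction (motive := fun u _ => (z⁻¹ • exteriorPower.map j f - 1 :
      Module.End F (⋀[F]^j V)) u ∈ exteriorCone b j fun I => ∑ x ∈ I.val, g x = γ ∧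
        d + (t + 1) ≤ ∑ x ∈ I.val, w x) ?_ ?_ ?_ ih
    · rintro _ ⟨I, ⟨hI, hIw⟩, rfl⟩
      obtain ⟨r, hr, hfr⟩ := exists_map_exteriorPower_basis_eq b hcov hg hw hf I
      rw [LinearMap.sub_apply, LinearMap.smul_apply, hfr, hγ I hI, inv_smul_smul₀ hz,
        Module.End.one_apply, add_sub_cancel_left]
      exact exteriorCone_mono b j (fun I' hI' => ⟨hI'.1.trans hI, by have := hI'.2; omega⟩) hr
    · rw [map_zero]
      exact zero_mem _
    · intro u v _ _ hu hv
      rw [map_add]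
      exact add_mem hu hv

theorem exists_pow_apply_exteriorPower_basis_eq {F V κ A : Type*} [Field F] [AddCommGroup V]
    [Module F V] [LinearOrder κ] [AddCommMonoid A] (b : Module.Basis κ F V)
    {nxt : κ → Option κ} (hcov : ∀ x y, nxt x = some y → x ⋖ y) {g : κ → A}
    (hg : ∀ x y, nxt x = some y → g y = g x) {w : κ → ℕ}
    (hw : ∀ x y, nxt x = some y → w y = w x + 1) {f : V →ₗ[F] V} {ξ : κ → F}
    (hf : ∀ x, f (b x) = ξ x • (b x + (nxt x).elim 0 b)) {j : ℕ} {γ : A} {z : F} (hz : z ≠ 0)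
    (hγ : ∀ I : Set.powersetCard κ j, ∑ x ∈ I.val, g x = γ → ∏ x ∈ I.val, ξ x = z)
    (I₀ : Set.powersetCard κ j) (hI₀ : ∑ x ∈ I₀.val, g x = γ) (t : ℕ)
    (hmove : ∀ I : Set.powersetCard κ j, ∑ x ∈ I.val, g x = γ →
      ∑ x ∈ I.val, w x < ∑ x ∈ I₀.val, w x + t → ∃ x ∈ I.val, ∃ y ∉ I.val, nxt x = some y) :
    ∃ I : Set.powersetCard κ j, ∑ x ∈ I.val, g x = γ ∧
      ∑ x ∈ I.val, w x = ∑ x ∈ I₀.val, w x + t ∧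
      ∃ r ∈ exteriorCone b j fun I => ∑ x ∈ I.val, g x = γ ∧ 0 ≤ ∑ x ∈ I.val, w x,
        ((z⁻¹ • exteriorPower.map j f - 1 : Module.End F (⋀[F]^j V)) ^ t)
          (b.exteriorPower j I₀) = b.exteriorPower j I + r := by
  induction t with
  | zero => exact ⟨I₀, hI₀, rfl, 0, zero_mem _, by simp⟩
  | succ t ih =>
    obtain ⟨I, hI, hIw, r, hr, hpow⟩ := ih fun I hI hlt => hmove I hI (by omega)
    obtain ⟨x, hx, y, hy, hxy⟩ := hmove I hI (by omega)
    obtain ⟨I', hI', hIw', r', hr', hfr⟩ :=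
      exists_map_exteriorPower_basis_eq_of_nxt b hcov hg hw hf I hx hy hxy
    refine ⟨I', hI'.trans hI, by omega,
      r' + (z⁻¹ • exteriorPower.map j f - 1 : Module.End F (⋀[F]^j V)) r, add_mem ?_ ?_, ?_⟩
    · exact exteriorCone_mono b j (fun I' hI' => ⟨hI'.1.trans hI, Nat.zero_le _⟩) hr'
    · have := pow_mem_exteriorCone b hcov hg hw hf hz hγ 0 1 hr
      rw [pow_one] at this
      exact exteriorCone_mono b j (fun I' hI' => ⟨hI'.1, Nat.zero_le _⟩) this
    · rw [pow_succ', Module.End.mul_apply, hpow, map_add, LinearMap.sub_apply,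
        LinearMap.smul_apply, hfr, hγ I hI, inv_smul_smul₀ hz, Module.End.one_apply]
      abel

theorem basis_add_ne_zero_of_mem_exteriorCone {F V κ : Type*} [Field F] [CharZero F]
    [AddCommGroup V] [Module F V] [LinearOrder κ] (b : Module.Basis κ F V) {j : ℕ}
    {P : Set.powersetCard κ j → Prop} (I : Set.powersetCard κ j) {r : ⋀[F]^j V}
    (hr : r ∈ exteriorCone b j P) : b.exteriorPower j I + r ≠ 0 := by
  intro h
  obtain ⟨c, hc⟩ := repr_mem_exteriorCone b j hr I
  have := congrArg (fun v => (b.exteriorPower j).repr v I) h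
  simp only [map_add, Finsupp.add_apply, Module.Basis.repr_self, Finsupp.single_eq_same, hc,
    map_zero, Finsupp.zero_apply] at this
  exact Nat.cast_add_one_ne_zero (R := F) c (by rw [add_comm]; exact this)

/-- In a Jordan basis with nonzero eigenvalues the vectors may be rescaled so that
`f` acts by `b (i, k) ↦ ξ i • (b (i, k) + b (i, k + 1))`. -/
theorem IsJordanBasis.exists_basis_lex {F V : Type*} [Field F] [AddCommGroup V] [Module F V]
    {f : V →ₗ[F] V} {q : ℕ} {m : Fin q → ℕ} {ξ : Fin q → F}
    {b : Module.Basis (Σ i, Fin (m i)) F V} (h : IsJordanBasis f m ξ b) (hξ : ∀ i, ξ i ≠ 0) :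
    ∃ b' : Module.Basis (Σₗ i, Fin (m i)) F V,
      ∀ x, f (b' x) = ξ (ofLex x).1 • (b' x + (nextInBlock x).elim 0 b') := by
  have hunit : ∀ x : Σ i, Fin (m i), IsUnit ((ξ x.1)⁻¹ ^ (x.2 : ℕ)) := fun x =>
    ((inv_ne_zero (hξ _)).isUnit).pow _
  let b' : Module.Basis (Σₗ i, Fin (m i)) F V := (b.isUnitSMul hunit).reindex toLex
  have hb' : ∀ i k, b' (toLex ⟨i, k⟩) = (ξ i)⁻¹ ^ (k : ℕ) • b ⟨i, k⟩ := fun i k => by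
    rw [Module.Basis.reindex_apply, Equiv.symm_apply_apply, Module.Basis.isUnitSMul_apply]
  refine ⟨b', fun x => ?_⟩
  obtain ⟨⟨i, k⟩, rfl⟩ := toLex.surjective x
  change _ = ξ i • _
  rw [smul_add, hb', map_smul, h i k, smul_add, smul_comm]
  congr 1
  by_cases hk : (k : ℕ) + 1 < m i
  · rw [dif_pos hk, show nextInBlock (toLex ⟨i, k⟩) = some (toLex ⟨i, ⟨k + 1, hk⟩⟩) from dif_pos hk,
      Option.elim_some, hb', pow_succ', mul_smul, smul_inv_smul₀ (hξ i)]
  · rw [dif_neg hk, show nextInBlock (toLex ⟨i, k⟩) = none from dif_neg hk,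
      Option.elim_none, smul_zero, smul_zero]

theorem eigenvalue_ne_zero_of_hasJordanForm {F V : Type*} [Field F] [AddCommGroup V] [Module F V]
    {M : V ≃ₗ[F] V} {q : ℕ} {m : Fin q → ℕ} {ξ : Fin q → F}
    (hm : ∀ i, 0 < m i) {b : Module.Basis (Σ i, Fin (m i)) F V}
    (h : IsJordanBasis (M : V →ₗ[F] V) m ξ b) (i : Fin q) : ξ i ≠ 0 := by
  intro h0
  have hk := h i ⟨m i - 1, by have := hm i; omega⟩
  rw [h0, zero_smul, zero_add, dif_neg (by simp only; have := hm i; omega)] at hk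
  exact b.ne_zero _ (M.map_eq_zero_iff.1 hk)

section BlockType

variable {q : ℕ} {m : Fin q → ℕ}

theorem sum_single_eq_iff_card_slice (I : Finset (Σₗ i, Fin (m i))) (s : Fin q → ℕ) :
    ∑ x ∈ I, (Pi.single (ofLex x).1 1 : Fin q → ℕ) = s ↔ ∀ i, (slice I i).card = s i := by
  simp only [funext_iff, card_slice]

theorem le_sum_position (I : Finset (Σₗ i, Fin (m i))) {s : Fin q → ℕ}
    (hs : ∀ i, (slice I i).card = s i) :
    ∑ i, ∑ k ∈ Finset.range (s i), k ≤ ∑ x ∈ I, ((ofLex x).2 : ℕ) := by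
  rw [sum_eq_sum_slice I fun _ k => k]
  exact Finset.sum_le_sum fun i _ => hs i ▸ sum_range_card_le_sum _

theorem sum_position_le (I : Finset (Σₗ i, Fin (m i))) {s : Fin q → ℕ}
    (hs : ∀ i, (slice I i).card = s i) :
    ∑ x ∈ I, ((ofLex x).2 : ℕ) ≤
      ∑ i, ∑ k ∈ Finset.range (s i), k + ∑ i, s i * (m i - s i) := by
  rw [sum_eq_sum_slice I fun _ k => k, ← Finset.sum_add_distrib]
  exact Finset.sum_le_sum fun i _ => hs i ▸ sum_le_sum_range_card_add _ _ (slice_subset_range I i)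

end BlockType

section Nilpotency

variable {F V : Type*} [Field F] [AddCommGroup V] [Module F V] {f : V →ₗ[F] V} {q : ℕ}
  {m : Fin q → ℕ} {ξ : Fin q → F}

theorem sub_algebraMap_pow_eq {E : Type*} [AddCommGroup E] [Module F E] (φ : Module.End F E)
    {z : F} (hz : z ≠ 0) (t : ℕ) :
    (φ - algebraMap F _ z) ^ t = z ^ t • (z⁻¹ • φ - 1) ^ t := by
  rw [← smul_pow, smul_sub, smul_inv_smul₀ hz, Algebra.algebraMap_eq_smul_one]

theorem pow_apply_exteriorPower_basis_eq_zero (hξ : ∀ i, ξ i ≠ 0)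
    (b : Module.Basis (Σₗ i, Fin (m i)) F V)
    (hf : ∀ x, f (b x) = ξ (ofLex x).1 • (b x + (nextInBlock x).elim 0 b)) {j : ℕ}
    {s : Fin q → ℕ} (I : Set.powersetCard (Σₗ i, Fin (m i)) j)
    (hI : ∀ i, (slice I.val i).card = s i) :
    ((exteriorPower.map j f - algebraMap F (Module.End F (⋀[F]^j V)) (∏ i, ξ i ^ s i)) ^
      (1 + ∑ i, s i * (m i - s i))) (b.exteriorPower j I) = 0 := by
  have hz : ∏ i, ξ i ^ s i ≠ 0 := Finset.prod_ne_zero_iff.2 fun i _ => pow_ne_zero _ (hξ i)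
  have hmem := pow_mem_exteriorCone b (j := j) (fun x y h => covBy_of_nextInBlock_eq_some h)
    (g := fun x => (Pi.single (ofLex x).1 1 : Fin q → ℕ)) (w := fun x => ((ofLex x).2 : ℕ))
    (fun x y h => by rw [(nextInBlock_eq_some h).1]) (fun x y h => (nextInBlock_eq_some h).2)
    hf (γ := s) hz
    (fun I hI => by
      rw [sum_single_eq_iff_card_slice] at hI
      simp only [prod_eq_prod_pow_card_slice, hI])
    (∑ i, ∑ k ∈ Finset.range (s i), k) (1 + ∑ i, s i * (m i - s i))
    (AddSubmonoid.subset_closure ⟨I, ⟨(sum_single_eq_iff_card_slice _ _).2 hI,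
      le_sum_position _ hI⟩, rfl⟩)
  rw [sub_algebraMap_pow_eq _ hz, LinearMap.smul_apply]
  refine smul_eq_zero_of_right _ ?_
  rw [exteriorCone, (?_ : {I : Set.powersetCard (Σₗ i, Fin (m i)) j | _} = ∅), Set.image_empty,
    AddSubmonoid.closure_empty, AddSubmonoid.mem_bot] at hmem
  · exact hmem
  · rw [Set.eq_empty_iff_forall_notMem]
    rintro I' ⟨h1, h2⟩
    have := sum_position_le I'.val ((sum_single_eq_iff_card_slice _ _).1 h1)
    omega

theorem exists_pow_apply_exteriorPower_basis_ne_zero [CharZero F] (hξ : ∀ i, ξ i ≠ 0)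
    (b : Module.Basis (Σₗ i, Fin (m i)) F V)
    (hf : ∀ x, f (b x) = ξ (ofLex x).1 • (b x + (nextInBlock x).elim 0 b)) {j : ℕ}
    {s : Fin q → ℕ} (hs : s ≤ m) (hsj : ∑ i, s i = j) :
    ∃ I : Set.powersetCard (Σₗ i, Fin (m i)) j, (∀ i, (slice I.val i).card = s i) ∧
    ((exteriorPower.map j f - algebraMap F (Module.End F (⋀[F]^j V)) (∏ i, ξ i ^ s i)) ^
      (∑ i, s i * (m i - s i))) (b.exteriorPower j I) ≠ 0 := by
  have hz : ∏ i, ξ i ^ s i ≠ 0 := Finset.prod_ne_zero_iff.2 fun i _ => pow_ne_zero _ (hξ i)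
  obtain ⟨I₀, hI₀⟩ := exists_slice_eq_range s hs
  have hcard : ∀ i, (slice I₀ i).card = s i := fun i => by rw [hI₀, Finset.card_range]
  have hI₀j : I₀.card = j := by rw [card_eq_sum_card_slice, ← hsj]; simp only [hcard]
  have hw₀ : ∑ x ∈ I₀, ((ofLex x).2 : ℕ) = ∑ i, ∑ k ∈ Finset.range (s i), k := by
    rw [sum_eq_sum_slice I₀ fun _ k => k]; simp only [hI₀]
  refine ⟨⟨I₀, hI₀j⟩, hcard, ?_⟩
  obtain ⟨I, -, -, r, hr, hpow⟩ := exists_pow_apply_exteriorPower_basis_eq b (j := j)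
    (fun x y h => covBy_of_nextInBlock_eq_some h)
    (g := fun x => (Pi.single (ofLex x).1 1 : Fin q → ℕ)) (w := fun x => ((ofLex x).2 : ℕ))
    (fun x y h => by rw [(nextInBlock_eq_some h).1]) (fun x y h => (nextInBlock_eq_some h).2)
    hf (γ := s) hz
    (fun I hI => by
      rw [sum_single_eq_iff_card_slice] at hI
      simp only [prod_eq_prod_pow_card_slice, hI])
    ⟨I₀, hI₀j⟩ ((sum_single_eq_iff_card_slice _ _).2 hcard) (∑ i, s i * (m i - s i))
    (fun I hI hlt => by
      rw [sum_single_eq_iff_card_slice] at hI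
      refine exists_nextInBlock_eq_some_of_sum_lt I.val (hlt.trans_eq ?_)
      simp only [hI, Finset.sum_add_distrib]
      rw [hw₀])
  rw [sub_algebraMap_pow_eq _ hz, LinearMap.smul_apply, hpow]
  exact smul_ne_zero (pow_ne_zero _ hz) (basis_add_ne_zero_of_mem_exteriorCone b I hr)

end Nilpotency

theorem mainTheorem7 {F V : Type*} [Field F] [IsAlgClosed F] [CharZero F] [DecidableEq F]
    [AddCommGroup V] [Module F V] [FiniteDimensional F V] [Nontrivial V]
    (M : V ≃ₗ[F] V) (q : ℕ) (m : Fin q → ℕ) (ξ : Fin q → F)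
    (hM : HasJordanForm (M : V →ₗ[F] V) m ξ) (j : ℕ) (hj : 0 < j) :
    (∃ (r : ℕ) (n : Fin r → ℕ) (η : Fin r → F),
      HasJordanForm (exteriorPower.map j (M : V →ₗ[F] V)) n η) ∧
    ∀ (r : ℕ) (n : Fin r → ℕ) (η : Fin r → F),
      HasJordanForm (exteriorPower.map j (M : V →ₗ[F] V)) n η →
      ∀ ζ : F,
        (Finset.univ.filter fun k : Fin r => η k = ζ).sup n =
          ((Finset.Iic m).filter fun s : Fin q → ℕ =>
              ∑ i, s i = j ∧ ∏ i, ξ i ^ s i = ζ).sup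
            fun s => 1 + ∑ i, s i * (m i - s i) := by
  refine ⟨exists_hasJordanForm _, fun r n η hn ζ => ?_⟩
  obtain ⟨hm, b₀, hb₀⟩ := hM
  rw [toMatrix_eq_blockDiagonal'_jordanBlock_iff] at hb₀
  have hξ := eigenvalue_ne_zero_of_hasJordanForm hm hb₀
  obtain ⟨b, hb⟩ := hb₀.exists_basis_lex hξ
  rw [hn.sup_eq_rootMultiplicity_minpoly ζ, ← Finset.filter_filter]
  symm
  refine sup_nilpotency_eq_rootMultiplicity_minpoly (T := Fin q → ℕ) (E := ⋀[F]^j V)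
    (exteriorPower.map j (M : V →ₗ[F] V)) ((Finset.Iic m).filter fun s => ∑ i, s i = j)
    (fun s => Submodule.span F (b.exteriorPower j '' {I | ∀ i, (slice I.val i).card = s i}))
    ?_ (fun s => ∏ i, ξ i ^ s i)
    (fun s => 1 + ∑ i, s i * (m i - s i)) ?_ ?_ ζ
  · rw [← top_le_iff, ← (b.exteriorPower j).span_eq, Submodule.span_le]
    rintro _ ⟨I, rfl⟩
    have hmem : (fun i => (slice I.val i).card) ∈
        (Finset.Iic m).filter fun s : Fin q → ℕ => ∑ i, s i = j := by
      rw [Finset.mem_filter, Finset.mem_Iic, ← card_eq_sum_card_slice]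
      exact ⟨fun i => by simpa using Finset.card_le_card (slice_subset_range I.val i), I.2⟩
    exact (le_iSup₂_of_le (f := fun (s : Fin q → ℕ)
      (_ : s ∈ (Finset.Iic m).filter fun s : Fin q → ℕ => ∑ i, s i = j) =>
        Submodule.span F (b.exteriorPower j '' {I | ∀ i, (slice I.val i).card = s i}))
      _ hmem le_rfl) (Submodule.subset_span ⟨I, fun _ => rfl, rfl⟩)
  · intro s _ w hw
    induction hw using Submodule.span_induction with
    | mem x hx =>
      obtain ⟨I, hI, rfl⟩ := hx
      exact pow_apply_exteriorPower_basis_eq_zero hξ b hb I hI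
    | zero => simp
    | add x y _ _ hx hy => rw [map_add, hx, hy, add_zero]
    | smul c x _ hx => rw [map_smul, hx, smul_zero]
  · intro s hs
    obtain ⟨hsm, hsj⟩ := Finset.mem_filter.1 hs
    obtain ⟨I, hI, hne⟩ := exists_pow_apply_exteriorPower_basis_ne_zero hξ b hb
      (Finset.mem_Iic.1 hsm) hsj
    refine ⟨_, Submodule.subset_span ⟨I, hI, rfl⟩, ?_⟩
    rw [Nat.add_sub_cancel_left]
    exact hne
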